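/- Let $n$ be an integer with $3\nmid n$. Put $\Delta_n=n^2+3n+9$, let $\rho_n\in\mathbb C$ be a root of $f_n(X)=X^3-nX^2-(n+3)X-1$, and let $L_n=\mathbb Q(\rho_n)$, which is a cyclic cubic field. Let $\sigma$ be a generator of $\mathrm{Gal}(L_n/\mathbb Q)$ and write $\rho_n'=\sigma(\rho_n)$, $\rho_n''=\sigma^2(\rho_n)$. A normal integral basis of $L_n$ is a $\mathbb Z$-basis of the ring of integers of $L_n$ of the form $\{\tau(\alpha)\mid\tau\in\mathrm{Gal}(L_n/\mathbb Q)\}$. Then $L_n$ has a normal integral basis of the form $\{v+w\rho_n,\ v+w\rho_n',\ v+w\rho_n''\}$ with $v,w\in\mathbb Z$ if and only if $\Delta_n$ is square-free. Furthermore, if $\Delta_n$ is square-free, then for $v,w\in\mathbb Z$ the set $\{v+w\rho_n,\ v+w\rho_n',\ v+w\rho_n''\}$ is a normal integral basis of $L_n$ if and only if $$w=\pm1\quad\text{and}\quad v=\frac13\,w\left(\left(\frac n3\right)-n\right),$$ where $\left(\frac n3\right)$ is the Legendre symbol. -/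

import Mathlib

open Polynomial NumberField IntermediateField

/-- Shanks' cubic polynomial `X³ - n X² - (n + 3) X - 1`. -/
noncomputable def shanksPoly (n : ℤ) : ℤ[X] :=
  X ^ 3 - C n * X ^ 2 - C (n + 3) * X - 1

/-- The integer `Δₙ = n² + 3 n + 9`. -/
def shanksDelta (n : ℤ) : ℤ := n ^ 2 + 3 * n + 9

/-- `S` is a normal integral basis of `K / ℚ`: for some algebraic integer `α` of `K`, the set `S`
is `{τ α | τ ∈ Gal(K/ℚ)}` and the family `(τ α)_τ` is a `ℤ`-basis of the ring of integers of `K`.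
(The existence of such a basis forces `|Gal(K/ℚ)| = [K : ℚ]` when `K` is a number field.) -/
def IsNormalIntegralBasis (K : Type*) [Field K] [Algebra ℚ K] (S : Set K) : Prop :=
  ∃ α : 𝓞 K, S = Set.range (fun τ : K ≃ₐ[ℚ] K => τ (α : K)) ∧
    ∃ b : Module.Basis (K ≃ₐ[ℚ] K) ℤ (𝓞 K), ∀ τ : K ≃ₐ[ℚ] K, (b τ : K) = τ (α : K)

/-- The set `{v + w ρ, v + w ρ', v + w ρ''}` in `ℚ(ρ)`, where `ρ' = σ ρ` and `ρ'' = σ² ρ`. -/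
def affineConjugates (ρ : ℂ) (σ : ℚ⟮ρ⟯ ≃ₐ[ℚ] ℚ⟮ρ⟯) (v w : ℤ) : Set ℚ⟮ρ⟯ :=
  {(v : ℚ⟮ρ⟯) + w * AdjoinSimple.gen ℚ ρ,
   (v : ℚ⟮ρ⟯) + w * σ (AdjoinSimple.gen ℚ ρ),
   (v : ℚ⟮ρ⟯) + w * σ (σ (AdjoinSimple.gen ℚ ρ))}

/-!
Write `x` for `ρ`, and `y`, `z` for the other two roots `-1 - 1 / x` and `-1 - 1 / y` of Shanks'
cubic; both lie in `ℤ[x]`, since `x` is a unit. Everything follows from the relations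
`x + y + z = n`, `x y = -x - 1`, `y z = -y - 1`, `z x = -z - 1` (`IsShanksTriple`), which are
stable under the automorphism `x ↦ y ↦ z ↦ x`.

If `{v + w x, v + w y, v + w z}` spans the ring of integers over `ℤ`, comparing coordinates in
`1, x, x²` shows that `w` and the trace `3 v + n w` are units and that the ring of integers
is `ℤ[x]`; conversely these conditions suffice, because the linear system expressing `1, x, x²`
through the three conjugates has determinant a unit. Modulo `3`, the trace being `±1` is the
stated formula for `v`.

There remains the equivalence of `𝓞 = ℤ[x]` with `Δ` square-free, where `θ = 3 x - n` satisfies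
`θ³ = 3 Δ θ + (2 n + 3) Δ`, with `3` and `2 n + 3` prime to `Δ`.

* Let `Δ` be square-free. Lagrange interpolation at the conjugates gives `Δ 𝓞 ⊆ ℤ[x]`, because
  the Vandermonde determinant of `x, y, z` is `±Δ` (`IsShanksTriple.exists_int_delta_mul`). So for
  integral `t` one has `9 t = (a + b θ + c θ²) / Δ` with integers `a, b, c`, and integrality of the
  norm forces `Δ` to divide them one after the other (`dvd_of_norm_eq`). This is Eisenstein's
  argument at all primes dividing `Δ` simultaneously (`IsShanksTriple.exists_int_coords`).
* If `d² ∣ Δ`, then `θ² / d` is integral, with `x²`-coordinate `9 / d`, so `𝓞 = ℤ[x]` forces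
  `d ∣ 9`, and `d` is a unit (`IsShanksTriple.squarefree_of_int_coords`).
-/

/-! ### The roots of Shanks' cubic -/

/-- `x, y, z` are the roots of Shanks' cubic, listed in the cyclic order `x ↦ -1 - 1 / x` in which
the Galois group permutes them. -/
structure IsShanksTriple {K : Type*} [Field K] (n : ℤ) (x y z : K) : Prop where
  sum_eq : x + y + z = n
  mul_xy : x * y = -x - 1
  mul_yz : y * z = -y - 1
  mul_zx : z * x = -z - 1

namespace IsShanksTriple

variable {K : Type*} [Field K] {n : ℤ} {x y z : K}

theorem of_root (hx : x ^ 3 = n * x ^ 2 + (n + 3) * x + 1) :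
    IsShanksTriple n x (n + 2 + n * x - x ^ 2) (-2 - (n + 1) * x + x ^ 2) where
  sum_eq := by ring
  mul_xy := by linear_combination -hx
  mul_yz := by linear_combination (n - x + 1) * hx
  mul_zx := by linear_combination hx

theorem rotate (h : IsShanksTriple n x y z) : IsShanksTriple n y z x :=
  ⟨by rw [← h.sum_eq]; ring, h.mul_yz, h.mul_zx, h.mul_xy⟩

theorem y_eq (h : IsShanksTriple n x y z) : y = n + 2 + n * x - x ^ 2 := by
  linear_combination (1 + x) * h.sum_eq - h.mul_xy - h.mul_zx

theorem z_eq (h : IsShanksTriple n x y z) : z = -2 - (n + 1) * x + x ^ 2 := by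
  linear_combination h.sum_eq - h.y_eq

theorem cubic (h : IsShanksTriple n x y z) : x ^ 3 = n * x ^ 2 + (n + 3) * x + 1 := by
  linear_combination x * h.y_eq - h.mul_xy

/-- The Vandermonde determinant of the roots is `±Δ`; hence the discriminant of the cubic is
`Δ²`. -/
theorem vandermonde (h : IsShanksTriple n x y z) :
    x ^ 2 * (y - z) + y ^ 2 * (z - x) + z ^ 2 * (x - y) = -(shanksDelta n : K) := by
  obtain ⟨h1, h2, h3, h4⟩ := h
  simp only [shanksDelta]
  push_cast
  have e1 : x ^ 2 * (y - z) = -x ^ 2 - z - 1 := by linear_combination x * h2 - x * h4 + h4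
  have e2 : y ^ 2 * (z - x) = -y ^ 2 - x - 1 := by linear_combination y * h3 - y * h2 + h2
  have e3 : z ^ 2 * (x - y) = -z ^ 2 - y - 1 := by linear_combination z * h4 - z * h3 + h3
  linear_combination e1 + e2 + e3 + 2 * h2 + 2 * h3 + 2 * h4 - (x + y + z + n + 3) * h1

/-- The product of the conjugates of `a + b θ + c θ²` for `θ = 3 x - n`, a root of
`X³ - 3 Δ X - (2 n + 3) Δ`. -/
theorem prod_eq (h : IsShanksTriple n x y z) (a b c : K) :
    (a + b * (3 * x - n) + c * (3 * x - n) ^ 2) * (a + b * (3 * y - n) + c * (3 * y - n) ^ 2) *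
      (a + b * (3 * z - n) + c * (3 * z - n) ^ 2) =
    a ^ 3 + shanksDelta n * (6 * a ^ 2 * c - 3 * a * b ^ 2 + (2 * n + 3) * b ^ 3
      - 3 * (2 * n + 3) * a * b * c)
      + (shanksDelta n) ^ 2 * (9 * a * c ^ 2 - 3 * (2 * n + 3) * b * c ^ 2
      + (2 * n + 3) ^ 2 * c ^ 3) := by
  have key : ∀ u v w q r : K, u + v + w = 0 → u * v + v * w + w * u = -q → u * v * w = r →
      (a + b * u + c * u ^ 2) * (a + b * v + c * v ^ 2) * (a + b * w + c * w ^ 2) =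
      a ^ 3 + r * b ^ 3 + r ^ 2 * c ^ 3 + 2 * q * a ^ 2 * c - q * a * b ^ 2 + q ^ 2 * a * c ^ 2
        - q * r * b * c ^ 2 - 3 * r * a * b * c := by
    intro u v w q r h1 h2 h3
    obtain rfl : w = -u - v := by linear_combination h1
    obtain rfl : q = -(u * v + v * (-u - v) + (-u - v) * u) := by linear_combination h2
    subst h3
    ring
  obtain ⟨h1, h2, h3, h4⟩ := h
  have e2 : x * y + y * z + z * x = -n - 3 := by linear_combination h2 + h3 + h4 - h1
  have e3 : x * y * z = 1 := by linear_combination z * h2 - h4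
  rw [key _ _ _ (3 * shanksDelta n) ((2 * n + 3) * shanksDelta n)]
  · ring
  · linear_combination 3 * h1
  · simp only [shanksDelta]
    push_cast
    linear_combination 9 * e2 - 6 * n * h1
  · simp only [shanksDelta]
    push_cast
    linear_combination 27 * e3 - 9 * n * e2 + 3 * n ^ 2 * h1

theorem eq_or_eq_or_eq {t : K} (h : IsShanksTriple n x y z)
    (ht : t ^ 3 = n * t ^ 2 + (n + 3) * t + 1) :
    t = x ∨ t = y ∨ t = z := by
  have e2 : x * y + y * z + z * x = -n - 3 := by
    linear_combination h.mul_xy + h.mul_yz + h.mul_zx - h.sum_eq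
  have e3 : x * y * z = 1 := by linear_combination z * h.mul_xy - h.mul_zx
  have : (t - x) * ((t - y) * (t - z)) = 0 := by
    linear_combination ht - t ^ 2 * h.sum_eq + t * e2 - e3
  simpa [sub_eq_zero] using this

end IsShanksTriple

/-! ### Arithmetic of `Δ` -/

theorem shanksDelta_ne_zero (n : ℤ) : shanksDelta n ≠ 0 := by
  simp only [shanksDelta]
  nlinarith [sq_nonneg (2 * n + 3)]

theorem isCoprime_three_shanksDelta {n : ℤ} (hn : ¬ (3 : ℤ) ∣ n) :
    IsCoprime 3 (shanksDelta n) := by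
  refine (Prime.coprime_iff_not_dvd Int.prime_three).2 fun h => hn ?_
  refine Int.prime_three.dvd_of_dvd_pow (n := 2) ?_
  have : n ^ 2 = shanksDelta n - 3 * (n + 3) := by simp only [shanksDelta]; ring
  rw [this]
  exact dvd_sub h (dvd_mul_right _ _)

theorem isCoprime_two_mul_add_three_shanksDelta {n : ℤ} (hn : ¬ (3 : ℤ) ∣ n) :
    IsCoprime (2 * n + 3) (shanksDelta n) := by
  -- `4 Δ - (2 n + 3)² = 27`, so a common divisor divides a power of `3`.
  have h27 : IsCoprime (27 : ℤ) (shanksDelta n) := by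
    simpa using (isCoprime_three_shanksDelta hn).pow_left (m := 3)
  have : (27 : ℤ) = (2 * n + 3) * (-(2 * n + 3)) + shanksDelta n * 4 := by
    simp only [shanksDelta]; ring
  rw [this, IsCoprime.add_mul_left_left_iff] at h27
  exact h27.of_mul_left_left

/-- If the norm of `(a + b θ + c θ²) / Δ` is an integer, then `Δ` divides `a`, `b` and `c`: the
argument for Eisenstein polynomials, carried out for all primes dividing `Δ` at once. -/
theorem dvd_of_norm_eq {D a b c n m : ℤ} (hD : Squarefree D) (hco : IsCoprime (2 * n + 3) D)
    (h : a ^ 3 + D * (6 * a ^ 2 * c - 3 * a * b ^ 2 + (2 * n + 3) * b ^ 3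
      - 3 * (2 * n + 3) * a * b * c)
      + D ^ 2 * (9 * a * c ^ 2 - 3 * (2 * n + 3) * b * c ^ 2
      + (2 * n + 3) ^ 2 * c ^ 3) = D ^ 3 * m) : D ∣ a ∧ D ∣ b ∧ D ∣ c := by
  have hD0 : D ≠ 0 := hD.ne_zero
  have ha : D ∣ a := by
    rw [← hD.dvd_pow_iff_dvd (n := 3) (by norm_num)]
    exact ⟨D ^ 2 * m - (6 * a ^ 2 * c - 3 * a * b ^ 2 + (2 * n + 3) * b ^ 3
      - 3 * (2 * n + 3) * a * b * c) - D * (9 * a * c ^ 2 - 3 * (2 * n + 3) * b * c ^ 2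
      + (2 * n + 3) ^ 2 * c ^ 3), by linear_combination h⟩
  obtain ⟨a, rfl⟩ := ha
  have hb : D ∣ b := by
    rw [← hD.dvd_pow_iff_dvd (n := 3) (by norm_num)]
    refine hco.symm.dvd_of_dvd_mul_left ⟨D * m - D * a ^ 3 - 6 * D * a ^ 2 * c + 3 * a * b ^ 2
      + 3 * (2 * n + 3) * a * b * c - 9 * D * a * c ^ 2 + 3 * (2 * n + 3) * b * c ^ 2
      - (2 * n + 3) ^ 2 * c ^ 3, mul_left_cancel₀ hD0 ?_⟩
    linear_combination h
  obtain ⟨b, rfl⟩ := hb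
  refine ⟨dvd_mul_right _ _, dvd_mul_right _ _, ?_⟩
  rw [← hD.dvd_pow_iff_dvd (n := 3) (by norm_num)]
  refine (hco.symm.pow_right (n := 2)).dvd_of_dvd_mul_left ⟨m - a ^ 3 - 6 * a ^ 2 * c
    + 3 * D * a * b ^ 2 - (2 * n + 3) * D * b ^ 3 + 3 * (2 * n + 3) * a * b * c - 9 * a * c ^ 2
    + 3 * (2 * n + 3) * b * c ^ 2, mul_left_cancel₀ (pow_ne_zero 2 hD0) ?_⟩
  linear_combination h

/-! ### Integral elements in the coordinates `1, x, x²` -/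

theorem exists_int_of_isIntegral_ratCast {K : Type*} [Field K] [Algebra ℚ K] {q : ℚ}
    (hq : IsIntegral ℤ (algebraMap ℚ K q)) : ∃ m : ℤ, q = m := by
  rw [isIntegral_algebraMap_iff (algebraMap ℚ K).injective] at hq
  obtain ⟨m, hm⟩ := IsIntegrallyClosed.isIntegral_iff.1 hq
  exact ⟨m, by simpa using hm.symm⟩

theorem isIntegral_of_cubic {K : Type*} [Field K] {t : K} {a b c : ℤ}
    (h : t ^ 3 = a * t ^ 2 + b * t + c) : IsIntegral ℤ t := by
  refine ⟨X ^ 3 - C a * X ^ 2 - C b * X - C c, by monicity!, ?_⟩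
  rw [← aeval_def]
  simp only [map_sub, map_mul, map_pow, aeval_X, aeval_C, algebraMap_int_eq, Int.coe_castRingHom]
  linear_combination h

namespace IsShanksTriple

variable {K : Type*} [Field K] {n : ℤ} {x y z : K}

theorem isIntegral (h : IsShanksTriple n x y z) : IsIntegral ℤ x := by
  refine isIntegral_of_cubic (a := n) (b := n + 3) (c := 1) ?_
  push_cast
  exact h.cubic

theorem map_cubic {F : Type*} [FunLike F K K] [RingHomClass F K K]
    (h : IsShanksTriple n x y z) (s : F) :
    s x ^ 3 = n * s x ^ 2 + (n + 3) * s x + 1 := by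
  have := congrArg s h.cubic
  simpa only [map_add, map_mul, map_pow, map_intCast, map_ofNat, map_one] using this

theorem map_y {F : Type*} [FunLike F K K] [RingHomClass F K K] {s : F}
    (h : IsShanksTriple n x y z) (hs : s x = y) : s y = z := by
  conv_lhs => rw [h.y_eq]
  rw [h.rotate.y_eq, ← hs]
  simp only [map_sub, map_add, map_mul, map_pow, map_intCast, map_ofNat]

/-- A `ℤ`-spanning set `v + w x, v + w y, v + w z` of the integers forces `w` and the trace
`3 v + n w` to be units, as the coordinates of `x` and of `1` show. -/
theorem isUnit_of_spanning [CharZero K] (h : IsShanksTriple n x y z)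
    (hind : ∀ A B C : ℚ, (A : K) + B * x + C * x ^ 2 = 0 → A = 0 ∧ B = 0 ∧ C = 0) {v w : ℤ}
    (H : ∀ t : K, IsIntegral ℤ t →
      ∃ a b c : ℤ, t = a * (v + w * x) + b * (v + w * y) + c * (v + w * z)) :
    IsUnit w ∧ IsUnit (3 * v + n * w) := by
  have hind' : ∀ A B C A' B' C' : ℤ, (A : K) + B * x + C * x ^ 2 = A' + B' * x + C' * x ^ 2 →
      A = A' ∧ B = B' ∧ C = C' := by
    intro A B C A' B' C' e
    obtain ⟨h1, h2, h3⟩ := hind (A - A') (B - B') (C - C')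
      (by push_cast; linear_combination e)
    rw [sub_eq_zero] at h1 h2 h3
    exact ⟨by exact_mod_cast h1, by exact_mod_cast h2, by exact_mod_cast h3⟩
  have expand : ∀ a b c : ℤ, (a : K) * (v + w * x) + b * (v + w * y) + c * (v + w * z) =
      ((v * (a + b + c) + w * ((n + 2) * b - 2 * c) : ℤ) : K)
        + ((w * (a + n * b - (n + 1) * c) : ℤ) : K) * x + ((w * (c - b) : ℤ) : K) * x ^ 2 := by
    intro a b c
    rw [h.y_eq, h.z_eq]
    push_cast
    ring
  have hw : IsUnit w := by
    obtain ⟨a, b, c, e⟩ := H x h.isIntegral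
    rw [expand] at e
    obtain ⟨-, h2, -⟩ := hind' 0 1 0 _ _ _ (by rw [← e]; simp)
    exact IsUnit.of_mul_eq_one _ h2.symm
  refine ⟨hw, ?_⟩
  obtain ⟨a, b, c, e⟩ := H 1 isIntegral_one
  rw [expand] at e
  obtain ⟨h1, h2, h3⟩ := hind' 1 0 0 _ _ _ (by rw [← e]; simp)
  obtain rfl : c = b := by
    have := (mul_eq_zero.1 h3.symm).resolve_left hw.ne_zero
    omega
  obtain rfl : a = c := by
    have := (mul_eq_zero.1 h2.symm).resolve_left hw.ne_zero
    linarith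
  exact IsUnit.of_mul_eq_one a (by rw [h1]; ring)

/-- If the `x²`-coordinate of every algebraic integer is an integer, then `Δ` is square-free: for
`d² ∣ Δ` the element `(3 x - n)² / d` is integral, and its `x²`-coordinate is `9 / d`. -/
theorem squarefree_of_int_coords [CharZero K] (h : IsShanksTriple n x y z) (hn : ¬ (3 : ℤ) ∣ n)
    (H : ∀ A B C : ℚ, IsIntegral ℤ ((A : K) + B * x + C * x ^ 2) → ∃ c : ℤ, C = c) :
    Squarefree (shanksDelta n) := by
  rintro d ⟨e, he⟩
  have hd0 : d ≠ 0 := by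
    rintro rfl
    exact shanksDelta_ne_zero n (by simpa using he)
  have hdK : (d : K) ≠ 0 := by exact_mod_cast hd0
  have heK : (n : K) ^ 2 + 3 * n + 9 = d * d * e := by
    have := congrArg (Int.cast : ℤ → K) he
    simpa [shanksDelta] using this
  have hint : IsIntegral ℤ ((3 * x - n) ^ 2 / d : K) := by
    have hθ : (3 * x - n) ^ 3 = 3 * (d * d * e) * (3 * x - n) + (2 * n + 3) * (d * d * e) := by
      rw [← heK]
      linear_combination 27 * h.cubic
    -- Squaring `θ (θ² - 3 Δ) = (2 n + 3) Δ` gives a cubic equation for `θ²`.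
    have hsq : (3 * x - n) ^ 2 * ((3 * x - n) ^ 2 - 3 * (d * d * e)) ^ 2
        = ((2 * n + 3) * (d * d * e)) ^ 2 := by
      linear_combination ((3 * x - n) ^ 3 - 3 * (d * d * e) * (3 * x - n)
        + (2 * n + 3) * (d * d * e)) * hθ
    refine isIntegral_of_cubic (a := 6 * d * e) (b := -(9 * d ^ 2 * e ^ 2))
      (c := (2 * n + 3) ^ 2 * d * e ^ 2) ?_
    push_cast
    field_simp
    linear_combination hsq
  obtain ⟨c, hc⟩ := H (n ^ 2 / d) (-6 * n / d) (9 / d) (by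
    convert! hint using 1
    push_cast
    ring)
  have hdQ : (d : ℚ) ≠ 0 := by exact_mod_cast hd0
  have h9 : d ∣ 3 ^ 2 := by
    refine ⟨c, ?_⟩
    rw [div_eq_iff hdQ] at hc
    rw [← Int.cast_inj (α := ℚ)]
    push_cast
    linear_combination hc
  exact ((isCoprime_three_shanksDelta hn).pow_left (m := 2)).isUnit_of_dvd' h9
    ⟨d * e, by rw [he]; ring⟩

variable [Algebra ℚ K] [CharZero K]

/-- Lagrange interpolation: the coordinates of an element in the basis `1, x, x²` are, up to the
denominator `Δ`, integral expressions in its conjugates and in `x, y, z`. -/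
theorem exists_int_delta_mul (h : IsShanksTriple n x y z) {s : K →ₐ[ℚ] K} (hs : s x = y)
    {A B C : ℚ} (hint : IsIntegral ℤ ((A : K) + B * x + C * x ^ 2)) :
    ∃ a b c : ℤ, shanksDelta n * A = a ∧ shanksDelta n * B = b ∧ shanksDelta n * C = c := by
  have i1 := h.isIntegral
  have i2 := h.rotate.isIntegral
  have i3 := h.rotate.rotate.isIntegral
  have j2 : IsIntegral ℤ ((A : K) + B * y + C * y ^ 2) := by
    simpa [hs] using map_isIntegral_int s hint
  have j3 : IsIntegral ℤ ((A : K) + B * z + C * z ^ 2) := by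
    simpa [h.map_y hs] using map_isIntegral_int s j2
  have V := h.vandermonde
  have kA : ∃ a : ℤ, shanksDelta n * A = a := by
    apply exists_int_of_isIntegral_ratCast (K := K)
    convert! (((hint.mul (i2.mul i3)).mul (i2.sub i3)).add
      ((j2.mul (i3.mul i1)).mul (i3.sub i1))).add ((j3.mul (i1.mul i2)).mul (i1.sub i2)) |>.neg
      using 1
    simp only [eq_ratCast]
    push_cast
    linear_combination (A : K) * V
  have kB : ∃ b : ℤ, shanksDelta n * B = b := by
    apply exists_int_of_isIntegral_ratCast (K := K)
    convert! ((hint.mul ((i2.pow 2).sub (i3.pow 2))).add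
      (j2.mul ((i3.pow 2).sub (i1.pow 2)))).add (j3.mul ((i1.pow 2).sub (i2.pow 2)))
      using 1
    simp only [eq_ratCast]
    push_cast
    linear_combination (B : K) * V
  have kC : ∃ c : ℤ, shanksDelta n * C = c := by
    apply exists_int_of_isIntegral_ratCast (K := K)
    convert! ((hint.mul (i2.sub i3)).add (j2.mul (i3.sub i1))).add (j3.mul (i1.sub i2)) |>.neg
      using 1
    simp only [eq_ratCast]
    push_cast
    linear_combination (C : K) * V
  obtain ⟨a, ha⟩ := kA
  obtain ⟨b, hb⟩ := kB
  obtain ⟨c, hc⟩ := kC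
  exact ⟨a, b, c, ha, hb, hc⟩

/-- If `Δ` is square-free and prime to `3`, then `1, x, x²` is an integral basis. -/
theorem exists_int_coords (h : IsShanksTriple n x y z) {s : K →ₐ[ℚ] K} (hs : s x = y)
    (hn : ¬ (3 : ℤ) ∣ n) (hD : Squarefree (shanksDelta n))
    {A B C : ℚ} (hint : IsIntegral ℤ ((A : K) + B * x + C * x ^ 2)) :
    ∃ a b c : ℤ, A = a ∧ B = b ∧ C = c := by
  obtain ⟨a, b, c, ha, hb, hc⟩ := h.exists_int_delta_mul hs hint
  have j2 : IsIntegral ℤ ((A : K) + B * y + C * y ^ 2) := by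
    simpa [hs] using map_isIntegral_int s hint
  have j3 : IsIntegral ℤ ((A : K) + B * z + C * z ^ 2) := by
    simpa [h.map_y hs] using map_isIntegral_int s j2
  -- In terms of `θ = 3 x - n` the element `9 (A + B x + C x²)` is `α + β θ + C θ²`.
  obtain ⟨α, hα⟩ : ∃ α : ℚ, α = 9 * A + 3 * n * B + n ^ 2 * C := ⟨_, rfl⟩
  obtain ⟨β, hβ⟩ : ∃ β : ℚ, β = 3 * B + 2 * n * C := ⟨_, rfl⟩
  have i9 : IsIntegral ℤ (9 : K) := by simpa using isIntegral_algebraMap (R := ℤ) (A := K) (x := 9)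
  obtain ⟨m, hm⟩ : ∃ m : ℤ, α ^ 3 + shanksDelta n * (6 * α ^ 2 * C - 3 * α * β ^ 2
      + (2 * n + 3) * β ^ 3 - 3 * (2 * n + 3) * α * β * C)
      + (shanksDelta n) ^ 2 * (9 * α * C ^ 2 - 3 * (2 * n + 3) * β * C ^ 2
      + (2 * n + 3) ^ 2 * C ^ 3) = m := by
    apply exists_int_of_isIntegral_ratCast (K := K)
    convert! ((i9.mul hint).mul (i9.mul j2)).mul (i9.mul j3) using 1
    have key : ∀ t : K, 9 * (A + B * t + C * t ^ 2) =
        α + β * (3 * t - n) + C * (3 * t - n) ^ 2 := by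
      intro t
      rw [hα, hβ]
      push_cast
      ring
    rw [key, key, key, h.prod_eq]
    simp only [eq_ratCast]
    push_cast
    rfl
  have hm' : (9 * a + 3 * n * b + n ^ 2 * c) ^ 3 +
      shanksDelta n * (6 * (9 * a + 3 * n * b + n ^ 2 * c) ^ 2 * c
      - 3 * (9 * a + 3 * n * b + n ^ 2 * c) * (3 * b + 2 * n * c) ^ 2
      + (2 * n + 3) * (3 * b + 2 * n * c) ^ 3
      - 3 * (2 * n + 3) * (9 * a + 3 * n * b + n ^ 2 * c) * (3 * b + 2 * n * c) * c)
      + (shanksDelta n) ^ 2 * (9 * (9 * a + 3 * n * b + n ^ 2 * c) * c ^ 2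
      - 3 * (2 * n + 3) * (3 * b + 2 * n * c) * c ^ 2
      + (2 * n + 3) ^ 2 * c ^ 3) = (shanksDelta n) ^ 3 * m := by
    rw [← Int.cast_inj (α := ℚ)]
    push_cast
    rw [← ha, ← hb, ← hc, ← hm, hα, hβ]
    ring
  obtain ⟨d1, d2, d3⟩ :=
    dvd_of_norm_eq hD (isCoprime_two_mul_add_three_shanksDelta hn) hm'
  have co := (isCoprime_three_shanksDelta hn).symm
  have db : shanksDelta n ∣ b :=
    co.dvd_of_dvd_mul_left ((dvd_add_left (d3.mul_left _)).1 d2)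
  have da : shanksDelta n ∣ a := by
    refine (co.pow_right (n := 2)).dvd_of_dvd_mul_left ?_
    rw [add_assoc] at d1
    simpa using (dvd_add_left (dvd_add (db.mul_left _) (d3.mul_left _))).1 d1
  obtain ⟨a, rfl⟩ := da
  obtain ⟨b, rfl⟩ := db
  obtain ⟨c, rfl⟩ := d3
  have hD0 : (shanksDelta n : ℚ) ≠ 0 := by exact_mod_cast shanksDelta_ne_zero n
  push_cast at ha hb hc
  exact ⟨a, b, c, mul_left_cancel₀ hD0 ha, mul_left_cancel₀ hD0 hb, mul_left_cancel₀ hD0 hc⟩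

end IsShanksTriple

/-! ### Normal integral bases -/

theorem IsNormalIntegralBasis.exists_int_combination {K : Type*} [Field K] [Algebra ℚ K]
    {p q r t : K} (h : IsNormalIntegralBasis K {p, q, r}) (ht : IsIntegral ℤ t) :
    ∃ a b c : ℤ, t = a * p + b * q + c * r := by
  obtain ⟨α, hS, b, hb⟩ := h
  have key : ∀ u ∈ Submodule.span ℤ (Set.range b), (u : K) ∈ Submodule.span ℤ {p, q, r} := by
    intro u hu
    induction hu using Submodule.span_induction with
    | mem u hu =>
      obtain ⟨τ, rfl⟩ := hu
      exact Submodule.subset_span (by rw [hS, hb]; exact ⟨τ, rfl⟩)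
    | zero => simp
    | add u v _ _ hu hv => simpa using add_mem hu hv
    | smul m u _ hu => simpa using Submodule.smul_mem _ m hu
  obtain ⟨a, b, c, e⟩ := Submodule.mem_span_triple.1 (key ⟨t, ht⟩ (b.mem_span _))
  exact ⟨a, b, c, by rw [← show _ = t from e]; simp⟩

/-- If the conjugates of an algebraic integer `α` span the ring of integers over `ℤ`, then they form
a normal integral basis. -/
theorem isNormalIntegralBasis_of_span {K : Type*} [Field K] [NumberField K] {α : K}
    (hα : IsIntegral ℤ α)
    (H : ∀ t : K, IsIntegral ℤ t →
      t ∈ Submodule.span ℤ (Set.range fun τ : K ≃ₐ[ℚ] K => τ α)) :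
    IsNormalIntegralBasis K (Set.range fun τ : K ≃ₐ[ℚ] K => τ α) := by
  have hli : LinearIndependent ℚ (fun τ : K ≃ₐ[ℚ] K => τ α) := by
    have hspan : ⊤ ≤ Submodule.span ℚ (Set.range fun τ : K ≃ₐ[ℚ] K => τ α) := by
      intro t _
      obtain ⟨m, hm, hmt⟩ := ((IsFractionRing.isAlgebraic_iff ℤ ℚ K).2
        (Algebra.IsAlgebraic.isAlgebraic (R := ℚ) t)).exists_integral_multiple
      have h1 := Submodule.span_subset_span ℤ ℚ _ (H _ hmt)
      have h2 := Submodule.smul_mem _ ((m : ℚ)⁻¹) h1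
      have hmK : (m : K) ≠ 0 := by exact_mod_cast hm
      convert! h2 using 1
      simp [Algebra.smul_def, hmK]
    -- There are at most `[K : ℚ]` automorphisms, so a spanning family of conjugates is free.
    exact linearIndependent_of_top_le_span_of_card_le_finrank hspan AlgEquiv.card_le
  let v : (K ≃ₐ[ℚ] K) → 𝓞 K := fun τ => ⟨τ α, map_isIntegral_int τ hα⟩
  let f : 𝓞 K →ₗ[ℤ] K := (algebraMap (𝓞 K) K).toIntAlgHom.toLinearMap
  have hf : Function.Injective f := RingOfIntegers.coe_injective
  have hli' : LinearIndependent ℤ v := LinearIndependent.of_comp f (hli.restrict_scalars' ℤ)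
  refine ⟨⟨α, hα⟩, rfl, Module.Basis.mk hli' ?_, fun τ => by rw [Module.Basis.mk_apply]; rfl⟩
  intro t _
  have h1 : f t ∈ Submodule.span ℤ (Set.range (f ∘ v)) := H t t.2
  rw [Set.range_comp, ← Submodule.map_span] at h1
  obtain ⟨u, hu, e⟩ := h1
  rwa [← hf e]

/-! ### The field `ℚ(ρ)` and its automorphisms -/

theorem shanksPoly_monic (n : ℤ) : (shanksPoly n).Monic := by
  unfold shanksPoly; monicity!

theorem shanksPoly_natDegree (n : ℤ) : (shanksPoly n).natDegree = 3 := by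
  unfold shanksPoly; compute_degree!

theorem shanksPoly_irreducible (n : ℤ) : Irreducible (shanksPoly n) := by
  rw [(shanksPoly_monic n).irreducible_iff_roots_eq_zero_of_degree_le_three
    (by rw [shanksPoly_natDegree]; norm_num) (by rw [shanksPoly_natDegree]),
    Multiset.eq_zero_iff_forall_notMem]
  intro a ha
  have h0 : a ^ 3 - n * a ^ 2 - (n + 3) * a - 1 = 0 := by
    simpa [shanksPoly] using isRoot_of_mem_roots ha
  -- The constant term shows that a root divides `1`.
  have hu : IsUnit a := IsUnit.of_mul_eq_one (a ^ 2 - n * a - (n + 3)) (by linear_combination h0)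
  rcases Int.isUnit_iff.1 hu with rfl | rfl
  · omega
  · omega

theorem minpoly_eq_shanksPoly {n : ℤ} {ρ : ℂ} (hρ : aeval ρ (shanksPoly n) = 0) :
    minpoly ℚ ρ = (shanksPoly n).map (algebraMap ℤ ℚ) := by
  refine (minpoly.eq_of_irreducible_of_monic ?_ ?_ ((shanksPoly_monic n).map _)).symm
  · exact ((shanksPoly_monic n).irreducible_iff_irreducible_map_fraction_map).1
      (shanksPoly_irreducible n)
  · rwa [aeval_map_algebraMap]

theorem PowerBasis.exists_algEquiv {F K : Type*} [Field F] [Field K] [Algebra F K]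
    (pb : PowerBasis F K) {y : K} (hy : aeval y (minpoly F pb.gen) = 0) :
    ∃ s : K ≃ₐ[F] K, s pb.gen = y := by
  have := pb.finite
  exact ⟨AlgEquiv.ofBijective (pb.lift y hy) (Algebra.IsAlgebraic.algHom_bijective _),
    pb.lift_gen y hy⟩

section ShanksField

variable {n : ℤ} {ρ : ℂ}

theorem isIntegral_of_shanksPoly_root (hρ : aeval ρ (shanksPoly n) = 0) : IsIntegral ℚ ρ :=
  IsIntegral.tower_top (R := ℤ) ⟨shanksPoly n, shanksPoly_monic n, by rwa [← aeval_def]⟩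

theorem gen_cubic (hρ : aeval ρ (shanksPoly n) = 0) :
    AdjoinSimple.gen ℚ ρ ^ 3 = n * AdjoinSimple.gen ℚ ρ ^ 2
      + (n + 3) * AdjoinSimple.gen ℚ ρ + 1 := by
  apply (algebraMap ℚ⟮ρ⟯ ℂ).injective
  simp only [shanksPoly, map_sub, map_mul, map_pow, map_one, aeval_X, aeval_C,
    algebraMap_int_eq, Int.coe_castRingHom] at hρ
  push_cast at hρ
  simp only [map_add, map_mul, map_pow, map_intCast, map_ofNat, map_one,
    AdjoinSimple.algebraMap_gen]
  linear_combination hρ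

theorem gen_coords_unique (hρ : aeval ρ (shanksPoly n) = 0) {A B C : ℚ}
    (h : (A : ℚ⟮ρ⟯) + B * AdjoinSimple.gen ℚ ρ + C * AdjoinSimple.gen ℚ ρ ^ 2 = 0) :
    A = 0 ∧ B = 0 ∧ C = 0 := by
  let p : ℚ[X] := Polynomial.C C * X ^ 2 + Polynomial.C B * X + Polynomial.C A
  have hp : p = 0 := by
    by_contra hp
    have h1 : aeval ρ p = 0 := by
      have := congrArg (algebraMap ℚ⟮ρ⟯ ℂ) h
      simp only [map_add, map_mul, map_pow, map_ratCast, map_zero,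
        AdjoinSimple.algebraMap_gen] at this
      simp only [p, map_add, map_mul, map_pow, aeval_X, aeval_C, eq_ratCast]
      linear_combination this
    have h2 := natDegree_le_of_dvd (minpoly.dvd ℚ ρ h1) hp
    rw [minpoly_eq_shanksPoly hρ, (shanksPoly_monic n).natDegree_map, shanksPoly_natDegree] at h2
    have h3 : p.natDegree ≤ 2 := natDegree_quadratic_le
    omega
  refine ⟨?_, ?_, ?_⟩
  · simpa [p] using congrArg (coeff · 0) hp
  · simpa [p, coeff_X, coeff_C] using congrArg (coeff · 1) hp
  · simpa [p, coeff_X, coeff_C] using congrArg (coeff · 2) hp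

theorem exists_gen_coords (hρ : aeval ρ (shanksPoly n) = 0) (t : ℚ⟮ρ⟯) :
    ∃ A B C : ℚ, t = A + B * AdjoinSimple.gen ℚ ρ + C * AdjoinSimple.gen ℚ ρ ^ 2 := by
  have hint := isIntegral_of_shanksPoly_root hρ
  have hdim : (adjoin.powerBasis hint).dim = 3 := by
    rw [adjoin.powerBasis_dim, minpoly_eq_shanksPoly hρ, (shanksPoly_monic n).natDegree_map,
      shanksPoly_natDegree]
  obtain ⟨p, hp, e⟩ := (adjoin.powerBasis hint).exists_eq_aeval t
  rw [hdim] at hp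
  rw [adjoin.powerBasis_gen, aeval_eq_sum_range' hp] at e
  refine ⟨p.coeff 0, p.coeff 1, p.coeff 2, ?_⟩
  rw [e]
  simp [Finset.sum_range_succ, Algebra.smul_def]

/-- The automorphism `ρ ↦ -1 - 1 / ρ = n + 2 + n ρ - ρ²`. -/
theorem exists_algEquiv_gen (hρ : aeval ρ (shanksPoly n) = 0) {y z : ℚ⟮ρ⟯}
    (h : IsShanksTriple n (AdjoinSimple.gen ℚ ρ) y z) :
    ∃ s : ℚ⟮ρ⟯ ≃ₐ[ℚ] ℚ⟮ρ⟯, s (AdjoinSimple.gen ℚ ρ) = y := by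
  have hint := isIntegral_of_shanksPoly_root hρ
  refine (adjoin.powerBasis hint).exists_algEquiv (y := y) ?_
  have hm : minpoly ℚ (adjoin.powerBasis hint).gen = (shanksPoly n).map (algebraMap ℤ ℚ) :=
    (minpoly_gen ℚ ρ).trans (minpoly_eq_shanksPoly hρ)
  refine (congrArg (aeval y) hm).trans ?_
  rw [aeval_map_algebraMap]
  simp only [shanksPoly, map_sub, map_mul, map_pow, map_one, aeval_X, aeval_C,
    algebraMap_int_eq, Int.coe_castRingHom]
  push_cast
  linear_combination h.rotate.cubic

theorem gen_algEquiv_ext (hρ : aeval ρ (shanksPoly n) = 0) {σ τ : ℚ⟮ρ⟯ ≃ₐ[ℚ] ℚ⟮ρ⟯}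
    (h : σ (AdjoinSimple.gen ℚ ρ) = τ (AdjoinSimple.gen ℚ ρ)) : σ = τ := by
  ext t
  obtain ⟨A, B, C, rfl⟩ := exists_gen_coords hρ t
  simp [h]

/-- A generator of the Galois group moves `ρ`, so it maps `ρ` to one of the other two roots. -/
theorem generator_apply_gen (hρ : aeval ρ (shanksPoly n) = 0) {y z : ℚ⟮ρ⟯}
    (h : IsShanksTriple n (AdjoinSimple.gen ℚ ρ) y z) {σ : ℚ⟮ρ⟯ ≃ₐ[ℚ] ℚ⟮ρ⟯}
    (hσ : ∀ τ : ℚ⟮ρ⟯ ≃ₐ[ℚ] ℚ⟮ρ⟯, τ ∈ Subgroup.zpowers σ) :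
    σ (AdjoinSimple.gen ℚ ρ) = y ∨ σ (AdjoinSimple.gen ℚ ρ) = z := by
  have hc : (σ (AdjoinSimple.gen ℚ ρ)) ^ 3 = n * (σ (AdjoinSimple.gen ℚ ρ)) ^ 2
      + (n + 3) * σ (AdjoinSimple.gen ℚ ρ) + 1 := h.map_cubic σ
  refine (h.eq_or_eq_or_eq hc).resolve_left fun h1 => ?_
  have hσ1 : σ = 1 := gen_algEquiv_ext hρ h1
  obtain ⟨s, hs⟩ := exists_algEquiv_gen hρ h
  have hs1 : s = 1 := by simpa [hσ1] using hσ s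
  rw [hs1, AlgEquiv.one_apply] at hs
  have h0 := h.y_eq
  rw [← hs] at h0
  obtain ⟨-, -, h2⟩ := gen_coords_unique hρ (A := -(n + 2)) (B := 1 - n) (C := 1)
    (by push_cast; linear_combination h0)
  exact one_ne_zero h2

/-- The set of conjugates does not depend on which of the two generators `σ` is. -/
theorem affineConjugates_eq (hρ : aeval ρ (shanksPoly n) = 0) {y z : ℚ⟮ρ⟯}
    (h : IsShanksTriple n (AdjoinSimple.gen ℚ ρ) y z) {σ : ℚ⟮ρ⟯ ≃ₐ[ℚ] ℚ⟮ρ⟯}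
    (hσ : ∀ τ : ℚ⟮ρ⟯ ≃ₐ[ℚ] ℚ⟮ρ⟯, τ ∈ Subgroup.zpowers σ) (v w : ℤ) :
    affineConjugates ρ σ v w =
      {(v : ℚ⟮ρ⟯) + w * AdjoinSimple.gen ℚ ρ, (v : ℚ⟮ρ⟯) + w * y, (v : ℚ⟮ρ⟯) + w * z} := by
  rw [affineConjugates]
  rcases generator_apply_gen hρ h hσ with h1 | h1
  · rw [h1, h.map_y h1]
  · have h2 : σ z = y := by
      have h3 := congrArg σ h.z_eq
      simp only [map_sub, map_add, map_mul, map_pow, map_neg, map_intCast, map_ofNat, map_one,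
        h1] at h3
      rw [h3, ← h.rotate.rotate.z_eq]
    rw [h1, h2, Set.pair_comm]

theorem range_algEquiv_apply (hρ : aeval ρ (shanksPoly n) = 0) {y z : ℚ⟮ρ⟯}
    (h : IsShanksTriple n (AdjoinSimple.gen ℚ ρ) y z) (v w : ℤ) :
    Set.range (fun τ : ℚ⟮ρ⟯ ≃ₐ[ℚ] ℚ⟮ρ⟯ => τ ((v : ℚ⟮ρ⟯) + w * AdjoinSimple.gen ℚ ρ)) =
      {(v : ℚ⟮ρ⟯) + w * AdjoinSimple.gen ℚ ρ, (v : ℚ⟮ρ⟯) + w * y, (v : ℚ⟮ρ⟯) + w * z} := by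
  obtain ⟨s, hs⟩ := exists_algEquiv_gen hρ h
  ext t
  simp only [Set.mem_range, Set.mem_insert_iff, Set.mem_singleton_iff, map_add, map_mul,
    map_intCast]
  constructor
  · rintro ⟨τ, rfl⟩
    have hc : (τ (AdjoinSimple.gen ℚ ρ)) ^ 3 = n * (τ (AdjoinSimple.gen ℚ ρ)) ^ 2
        + (n + 3) * τ (AdjoinSimple.gen ℚ ρ) + 1 := h.map_cubic τ
    rcases h.eq_or_eq_or_eq hc with e | e | e <;> simp [e]
  · rintro (rfl | rfl | rfl)
    · exact ⟨1, rfl⟩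
    · exact ⟨s, by rw [hs]⟩
    · exact ⟨s * s, by rw [AlgEquiv.mul_apply, hs, h.map_y hs]⟩

/-! ### The criterion -/

/-- Modulo `3` the trace `3 v + n w` is `w` times the Legendre symbol of `n`, so for
`w = ±1` it is a unit only if it equals that product. -/
theorem isUnit_trace_iff {n v w : ℤ} (hn : ¬ (3 : ℤ) ∣ n) :
    (IsUnit w ∧ IsUnit (3 * v + n * w)) ↔
      (w = 1 ∨ w = -1) ∧ (v : ℚ) = (1 / 3 : ℚ) * w * ((legendreSym 3 n : ℚ) - n) := by
  have hv : (v : ℚ) = (1 / 3 : ℚ) * w * ((legendreSym 3 n : ℚ) - n) ↔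
      3 * v = w * (legendreSym 3 n - n) := by
    rw [← Int.cast_inj (α := ℚ)]
    push_cast
    constructor <;> intro h <;> linarith
  have h3 : n % 3 = 1 ∨ n % 3 = 2 := by omega
  have hl : (n % 3 = 1 ∧ legendreSym 3 n = 1) ∨ (n % 3 = 2 ∧ legendreSym 3 n = -1) := by
    rcases h3 with h | h
    · left
      refine ⟨h, ?_⟩
      rw [legendreSym.mod]
      push_cast
      rw [h]
      decide
    · right
      refine ⟨h, ?_⟩
      rw [legendreSym.mod]
      push_cast
      rw [h]
      decide
  rw [hv, Int.isUnit_iff, Int.isUnit_iff, and_congr_right_iff]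
  rintro (rfl | rfl) <;> rcases hl with ⟨h, e⟩ | ⟨h, e⟩ <;> rw [e] <;> omega

/-- `{v + w ρ, v + w ρ', v + w ρ''}` is a normal integral basis exactly when `w` and the trace
`3 v + n w` are units and `Δ` is square-free. -/
theorem isNormalIntegralBasis_affineConjugates_iff (hρ : aeval ρ (shanksPoly n) = 0)
    (hn : ¬ (3 : ℤ) ∣ n) {σ : ℚ⟮ρ⟯ ≃ₐ[ℚ] ℚ⟮ρ⟯}
    (hσ : ∀ τ : ℚ⟮ρ⟯ ≃ₐ[ℚ] ℚ⟮ρ⟯, τ ∈ Subgroup.zpowers σ) (v w : ℤ) :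
    IsNormalIntegralBasis ℚ⟮ρ⟯ (affineConjugates ρ σ v w) ↔
      (IsUnit w ∧ IsUnit (3 * v + n * w)) ∧ Squarefree (shanksDelta n) := by
  have h := IsShanksTriple.of_root (gen_cubic hρ)
  rw [affineConjugates_eq hρ h hσ]
  constructor
  · intro hB
    have H := fun t ht => hB.exists_int_combination (t := t) ht
    refine ⟨h.isUnit_of_spanning (fun _ _ _ => gen_coords_unique hρ) H,
      h.squarefree_of_int_coords hn fun A B C hint => ?_⟩
    obtain ⟨a, b, c, e⟩ := H _ hint
    obtain ⟨-, -, h3⟩ := gen_coords_unique hρ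
      (A := A - (v * (a + b + c) + w * ((n + 2) * b - 2 * c)))
      (B := B - w * (a + n * b - (n + 1) * c)) (C := C - w * (c - b))
      (by push_cast; linear_combination e)
    exact ⟨w * (c - b), by push_cast; linear_combination h3⟩
  · rintro ⟨⟨hw, hT⟩, hD⟩
    have : NumberField ℚ⟮ρ⟯ :=
      { to_charZero := inferInstance
        to_finiteDimensional := adjoin.finiteDimensional (isIntegral_of_shanksPoly_root hρ) }
    obtain ⟨s, hs⟩ := exists_algEquiv_gen hρ h
    rw [← range_algEquiv_apply hρ h]
    have hi : ∀ k : ℤ, IsIntegral ℤ (k : ℚ⟮ρ⟯) := fun k => by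
      simpa using isIntegral_algebraMap (R := ℤ) (A := ℚ⟮ρ⟯) (x := k)
    refine isNormalIntegralBasis_of_span ((hi v).add ((hi w).mul h.isIntegral)) fun t ht => ?_
    obtain ⟨A, B, C, rfl⟩ := exists_gen_coords hρ t
    obtain ⟨a, b, c, rfl, rfl, rfl⟩ := h.exists_int_coords (s := s.toAlgHom) hs hn hD ht
    rw [range_algEquiv_apply hρ h, Submodule.mem_span_triple]
    -- `w² = (3 v + n w)² = 1`; the coefficients solve the triangular system for the coordinates.
    have hw2 : (w : ℚ⟮ρ⟯) * w = 1 := by exact_mod_cast Int.isUnit_mul_self hw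
    have hT2 : (3 * v + n * w : ℚ⟮ρ⟯) * (3 * v + n * w) = 1 := by
      exact_mod_cast Int.isUnit_mul_self hT
    obtain ⟨e, he⟩ : ∃ e : ℤ, e = a - v * w * b - v * w * (n + 2) * c + 2 * c := ⟨_, rfl⟩
    have heK : (e : ℚ⟮ρ⟯) = a - v * w * b - v * w * (n + 2) * c + 2 * c := by
      rw [he]; push_cast; rfl
    refine ⟨w * b + (3 * v + n * w) * e + (n + 1) * w * c, (3 * v + n * w) * e,
      (3 * v + n * w) * e + w * c, ?_⟩
    simp only [zsmul_eq_mul]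
    push_cast
    linear_combination (e : ℚ⟮ρ⟯) * hT2
      + (c * AdjoinSimple.gen ℚ ρ ^ 2 + b * AdjoinSimple.gen ℚ ρ - 2 * c) * hw2 + heK

end ShanksField

theorem mainTheorem6 (n : ℤ) (hn : ¬ (3 : ℤ) ∣ n)
    (ρ : ℂ) (hρ : aeval ρ (shanksPoly n) = 0)
    (σ : ℚ⟮ρ⟯ ≃ₐ[ℚ] ℚ⟮ρ⟯) (hσ : ∀ τ : ℚ⟮ρ⟯ ≃ₐ[ℚ] ℚ⟮ρ⟯, τ ∈ Subgroup.zpowers σ) :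
    ((∃ v w : ℤ, IsNormalIntegralBasis ℚ⟮ρ⟯ (affineConjugates ρ σ v w)) ↔
      Squarefree (shanksDelta n)) ∧
    (Squarefree (shanksDelta n) →
      ∀ v w : ℤ, IsNormalIntegralBasis ℚ⟮ρ⟯ (affineConjugates ρ σ v w) ↔
        (w = 1 ∨ w = -1) ∧ (v : ℚ) = (1 / 3 : ℚ) * w * ((legendreSym 3 n : ℚ) - n)) := by
  simp only [isNormalIntegralBasis_affineConjugates_iff hρ hn hσ]
  refine ⟨⟨fun ⟨_, _, h⟩ => h.2, fun hD => ?_⟩, fun hD v w => ?_⟩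
  · have h3 : n % 3 = 1 ∨ n % 3 = 2 := by omega
    rcases h3 with h | h
    -- With `w = 1`, a `v` with `3 v + n = ±1`.
    · exact ⟨-(n / 3), 1, ⟨isUnit_one, Int.isUnit_iff.2 (by omega)⟩, hD⟩
    · exact ⟨-(n / 3) - 1, 1, ⟨isUnit_one, Int.isUnit_iff.2 (by omega)⟩, hD⟩
  · rw [← isUnit_trace_iff hn, and_iff_left hD]
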